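/- For a measurable function $f:[0,1]\to\mathbb{C}$ let $f^*(t)=\inf\{s\ge 0: |\{x\in[0,1]:|f(x)|>s\}|\le t\}$ be the non-increasing rearrangement of $|f|$, and for a family $c=(c_n)_{n\in I}$ of complex numbers let $c_k^*=\inf\{s\ge 0:\#\{n\in I:|c_n|>s\}<k\}$ $(k=1,2,\dots)$ be the non-increasing rearrangement of $(|c_n|)$. For $\beta\in\mathbb{R}$ let $L_{2,2}(\log L)_\beta$ be the set of measurable $f:[0,1]\to\mathbb{C}$ (functions that agree almost everywhere being identified) with $$\|f\|_{L_{2,2}(\log L)_\beta}:=\Big(\int_0^1\big[(1+|\log t|)^{\beta}f^*(t)\big]^2\,dt\Big)^{1/2}<\infty,$$ and let $l_{2,2}(\log l)_\beta$ be the set of bounded families $c$ with $$\|c\|_{l_{2,2}(\log l)_\beta}:=\Big(\sum_{k=1}^\infty\big[(1+\log k)^{\beta}c_k^*\big]^2\Big)^{1/2}<\infty.$$ Let $\alpha<-1/2$. Then there is a constant $C>0$, depending only on $\alpha$, such that the following holds. Let $I$ be a non-empty, at most countable index set (for example $\mathbb{N}$ or $\mathbb{Z}$), let $(\varphi_n)_{n\in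 I}$ be an orthonormal system in $L_2([0,1])$ with $M:=\sup_{n\in I}\|\varphi_n\|_{L_\infty}<\infty$, and let $f\in L_{2,2}(\log L)_{\alpha+1/2}$. Then every function $f\,\overline{\varphi_n}$ is integrable on $[0,1]$, the family $\mathcal{F}(f)=(c_n(f))_{n\in I}$ of Fourier coefficients $c_n(f)=\int_0^1 f(x)\overline{\varphi_n(x)}\,dx$ belongs to $l_{2,2}(\log l)_{\alpha+1/2}$, and $$\|\mathcal{F}(f)\|_{l_{2,2}(\log l)_{\alpha+1/2}}\le C\,\min\big(M,(1+\log M)^{|\alpha|}\big)\,\|f\|_{L_{2,2}(\log L)_{\alpha+1/2}}.$$ -/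

import Mathlib

open MeasureTheory Set
open scoped ENNReal ComplexConjugate

noncomputable section

/-- Lebesgue measure on the unit interval `[0, 1]`. -/
abbrev unitMeasure : Measure ℝ := volume.restrict (Icc (0 : ℝ) 1)

/-- The non-increasing rearrangement of `|f|` for a function `f` on `[0, 1]`:
`f^*(t) = inf {s ≥ 0 : |{x ∈ [0, 1] : |f x| > s}| ≤ t}`. -/
def rearrangement (f : ℝ → ℂ) (t : ℝ) : ℝ≥0∞ :=
  sInf {s : ℝ≥0∞ | unitMeasure {x | s < ‖f x‖ₑ} ≤ ENNReal.ofReal t}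

/-- The non-increasing rearrangement `c_1^* ≥ c_2^* ≥ …` of the family `|c n|`:
`c_k^* = inf {s ≥ 0 : #{n : |c n| > s} < k}` for `k ≥ 1`.
For `k = 1` it is the supremum of the family. -/
def seqRearrangement {ι : Type*} (c : ι → ℂ) (k : ℕ) : ℝ≥0∞ :=
  sInf {s : ℝ≥0∞ | {n | s < ‖c n‖ₑ}.encard < (k : ℕ∞)}

/-- The quasi-norm `‖ t^{1/p - 1/q} (1 + |log t|)^a f^*(t) | L_q(0, 1) ‖` of the Lorentz–Zygmund
space `L_{p,q}(log L)_a`, where `1/∞ = 0`. -/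
def lorentzZygmundNorm (p q : ℝ≥0∞) (a : ℝ) (f : ℝ → ℂ) : ℝ≥0∞ :=
  eLpNorm (fun t : ℝ =>
      ENNReal.ofReal (t ^ (p.toReal⁻¹ - q.toReal⁻¹) * (1 + |Real.log t|) ^ a) * rearrangement f t)
    q (volume.restrict (Ioo (0 : ℝ) 1))

/-- Membership in the Lorentz–Zygmund space `L_{p,q}(log L)_a` on `[0, 1]`. -/
def MemLorentzZygmund (p q : ℝ≥0∞) (a : ℝ) (f : ℝ → ℂ) : Prop :=
  AEStronglyMeasurable f unitMeasure ∧ lorentzZygmundNorm p q a f < ∞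

/-- The quasi-norm `‖ k^{1/p - 1/q} (1 + log k)^a c_k^* | l_q ‖` (`k = 1, 2, …`) of the
Lorentz–Zygmund sequence space `l_{p,q}(log l)_a`. The summation index is `j = k - 1`. -/
def seqLorentzZygmundNorm {ι : Type*} (p q : ℝ≥0∞) (a : ℝ) (c : ι → ℂ) : ℝ≥0∞ :=
  eLpNorm (fun j : ℕ =>
      ENNReal.ofReal (((j + 1 : ℕ) : ℝ) ^ (p.toReal⁻¹ - q.toReal⁻¹) *
        (1 + Real.log ((j + 1 : ℕ) : ℝ)) ^ a) * seqRearrangement c (j + 1))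
    q Measure.count

/-- Membership in the Lorentz–Zygmund sequence space `l_{p,q}(log l)_a` of bounded families. -/
def MemSeqLorentzZygmund {ι : Type*} (p q : ℝ≥0∞) (a : ℝ) (c : ι → ℂ) : Prop :=
  (∃ B : ℝ, ∀ n, ‖c n‖ ≤ B) ∧ seqLorentzZygmundNorm p q a c < ∞

/-- The Fourier series map: `c_n(f) = ∫_0^1 f(x) conj(φ_n(x)) dx`. -/
def fourierMap {ι : Type*} (φ : ι → Lp ℂ 2 unitMeasure) (f : ℝ → ℂ) (n : ι) : ℂ :=
  ∫ x, f x * conj (φ n x) ∂unitMeasure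

end

/-! ### Rearrangement of functions: equimeasurability and truncation at the height `f^*(t)`. -/

section Rearrangement

/-! Put `g = -(2α+1) > 0`, so the squared norms are `l_2` and `L_2` norms with decreasing weights
`(1 + log k)^(-g)` and `(1 + |log u|)^(-g)`. The function `f` need not lie in `L_2`, so Bessel's
inequality is applied only to a truncation.

Fix `j` and cut `f` at the height `f^*(t)`, `t = 1/(M²j)`. The low part is in `L_2` and Bessel
applies; the high part has coefficients at most `M ∫_0^t f^*`. Both contributions to `∑_{k≤j}
(c_k^*)²` are controlled by the damped energy `E(t) = ∫_0^1 min(1, √(u/t)) f^*(u)² du`, which gives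
`sum_range_seqRearrangement_sq_le`.

The sequence weight is then dominated by a positive combination, with coefficients `v_i`, of
indicators of `{k ≤ 2^i}` (`tsum_log_weight_mul_le`). Summing the block estimates and exchanging sum
and integral leaves the scalar bound `∑ v_i min(1, √(u M² 2^i)) ≲ (1 + log M²)^g (1 + |log u|)^(-g)`
(`tsum_dyadicIncrement_min_le_log`). It relies on the decay of the damping factor for `u < t`.

Taking square roots leaves the factor `(1 + log M)^(g/2)`, where `g/2 = |α| - 1/2`. As a power of a
logarithm it is also `O(M)`, whence the minimum (`rpow_one_add_log_sq_le`). -/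

theorem rearrangement_antitone (f : ℝ → ℂ) : Antitone (rearrangement f) := fun _ _ h =>
  sInf_le_sInf fun _ hs => le_trans hs (ENNReal.ofReal_le_ofReal h)

theorem measurable_rearrangement (f : ℝ → ℂ) : Measurable (rearrangement f) :=
  (rearrangement_antitone f).measurable

/-- The distribution function is right-continuous in the height: the sets `{|f| > u n}` increase to
`{|f| > s}` as `u n` decreases to `s`. -/
theorem lt_rearrangement_iff (f : ℝ → ℂ) (t : ℝ) (s : ℝ≥0∞) :
    s < rearrangement f t ↔ ENNReal.ofReal t < unitMeasure {x | s < ‖f x‖ₑ} := by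
  constructor
  · intro h
    by_contra! hc
    exact absurd (sInf_le (a := s) hc) (not_le.2 h)
  · intro h
    have hs : s < ⊤ := by
      by_contra! hs
      rw [top_le_iff.1 hs] at h
      simp at h
    obtain ⟨u, hu, hus, hlim⟩ := exists_seq_strictAnti_tendsto' hs
    have hunion : {x | s < ‖f x‖ₑ} = ⋃ n, {x | u n < ‖f x‖ₑ} := by
      ext x
      simp only [mem_iUnion]
      constructor
      · intro hx
        exact ((hlim.eventually_lt_const hx).exists)
      · rintro ⟨n, hn⟩
        exact (hus n).1.trans hn
    have hmono : Monotone fun n => {x | u n < ‖f x‖ₑ} := fun m n hmn x hx =>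
      (hu.antitone hmn).trans_lt hx
    rw [hunion, hmono.measure_iUnion] at h
    obtain ⟨n, hn⟩ := lt_iSup_iff.1 h
    refine (hus n).1.trans_le (le_sInf fun r hr => ?_)
    by_contra! hrn
    exact absurd (hn.trans_le (measure_mono fun x hx => hrn.trans hx)) (not_lt.2 hr)

instance : IsProbabilityMeasure unitMeasure := ⟨by simp⟩

theorem volume_Ioo_inter_lt_ofReal {d : ℝ≥0∞} (hd : d ≤ 1) :
    volume ({u : ℝ | ENNReal.ofReal u < d} ∩ Ioo 0 1) = d := by
  lift d to NNReal using ne_top_of_le_ne_top ENNReal.one_ne_top hd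
  have hd' : (d : ℝ) ≤ 1 := by exact_mod_cast hd
  have : {u : ℝ | ENNReal.ofReal u < d} ∩ Ioo 0 1 = Ioo 0 (d : ℝ) := by
    ext u
    simp only [mem_inter_iff, mem_ofPred_eq, mem_Ioo]
    constructor
    · rintro ⟨h, h0, -⟩
      refine ⟨h0, ?_⟩
      rwa [← ENNReal.ofReal_coe_nnreal, ENNReal.ofReal_lt_ofReal_iff_of_nonneg h0.le] at h
    · rintro ⟨h0, h⟩
      refine ⟨?_, h0, h.trans_le hd'⟩
      rwa [← ENNReal.ofReal_coe_nnreal, ENNReal.ofReal_lt_ofReal_iff_of_nonneg h0.le]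
  rw [this, Real.volume_Ioo, sub_zero, ENNReal.ofReal_coe_nnreal]

/-- `|f|` and its rearrangement are equimeasurable. -/
theorem map_enorm_eq_map_rearrangement {f : ℝ → ℂ} (hf : AEStronglyMeasurable f unitMeasure) :
    unitMeasure.map (fun x => ‖f x‖ₑ) =
      (volume.restrict (Ioo (0 : ℝ) 1)).map (rearrangement f) := by
  have hfm : AEMeasurable (fun x => ‖f x‖ₑ) unitMeasure := hf.enorm
  have : IsFiniteMeasure (unitMeasure.map fun x => ‖f x‖ₑ) := inferInstance
  refine ext_of_generate_finite (range Ioi) ?_ isPiSystem_Ioi ?_ ?_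
  · rw [← borel_eq_generateFrom_Ioi]
    exact BorelSpace.measurable_eq
  · rintro _ ⟨s, rfl⟩
    rw [Measure.map_apply_of_aemeasurable hfm measurableSet_Ioi,
      Measure.map_apply (measurable_rearrangement f) measurableSet_Ioi,
      Measure.restrict_apply (measurable_rearrangement f measurableSet_Ioi)]
    have : rearrangement f ⁻¹' Ioi s
        = {u : ℝ | ENNReal.ofReal u < unitMeasure {x | s < ‖f x‖ₑ}} := by
      ext u
      exact lt_rearrangement_iff f u s
    rw [this, volume_Ioo_inter_lt_ofReal prob_le_one]
    rfl
  · rw [Measure.map_apply_of_aemeasurable hfm .univ,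
      Measure.map_apply (measurable_rearrangement f) .univ]
    simp

theorem lintegral_comp_enorm_eq_rearrangement {f : ℝ → ℂ}
    (hf : AEStronglyMeasurable f unitMeasure) {g : ℝ≥0∞ → ℝ≥0∞} (hg : Measurable g) :
    ∫⁻ x, g ‖f x‖ₑ ∂unitMeasure = ∫⁻ u in Ioo (0 : ℝ) 1, g (rearrangement f u) := by
  rw [← lintegral_map' (f := g) hg.aemeasurable hf.enorm, map_enorm_eq_map_rearrangement hf,
    lintegral_map hg (measurable_rearrangement f)]

/-- By equimeasurability the integral can be taken over `{u : f^*(u) > f^*(t)}`, and monotonicity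
places this set to the left of `t`. -/
theorem lintegral_enorm_indicator_gt_le {f : ℝ → ℂ} (hf : AEStronglyMeasurable f unitMeasure)
    {t : ℝ} (ht : t ≤ 1) :
    ∫⁻ x, ‖{x | rearrangement f t < ‖f x‖ₑ}.indicator f x‖ₑ ∂unitMeasure ≤
      ∫⁻ u in Ioo (0 : ℝ) t, rearrangement f u := by
  have h := lintegral_comp_enorm_eq_rearrangement hf
    (g := (Ioi (rearrangement f t)).indicator id) (measurable_id.indicator measurableSet_Ioi)
  have h1 : ∀ x, ‖{x | rearrangement f t < ‖f x‖ₑ}.indicator f x‖ₑ =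
      (Ioi (rearrangement f t)).indicator id ‖f x‖ₑ := by
    intro x
    by_cases hx : rearrangement f t < ‖f x‖ₑ <;> simp [indicator, hx]
  simp_rw [h1]
  have h2 : ∫⁻ u in Ioo (0 : ℝ) t, rearrangement f u =
      ∫⁻ u in Ioo (0 : ℝ) 1, (Ioo 0 t).indicator (rearrangement f) u := by
    rw [lintegral_indicator measurableSet_Ioo, Measure.restrict_restrict measurableSet_Ioo,
      inter_eq_self_of_subset_left (Ioo_subset_Ioo_right ht)]
  rw [h, h2]
  refine setLIntegral_mono ((measurable_rearrangement f).indicator measurableSet_Ioo)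
    fun u hu => ?_
  by_cases hut : u < t
  · rw [indicator_of_mem (s := Ioo 0 t) ⟨hu.1, hut⟩]
    exact indicator_le_self _ _ _
  · have := rearrangement_antitone f (not_lt.1 hut)
    rw [indicator_of_notMem (by simpa using this)]
    exact zero_le

/-- The extra term `t f^*(t)²` is needed because `f^*` may be constant on an interval ending at `t`,
so that `{f^* ≤ f^*(t)}` reaches to the left of `t`. -/
theorem lintegral_enorm_sq_indicator_compl_le {f : ℝ → ℂ}
    (hf : AEStronglyMeasurable f unitMeasure) {t : ℝ} (ht0 : 0 < t) (ht : t ≤ 1) :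
    ∫⁻ x, ‖{x | rearrangement f t < ‖f x‖ₑ}ᶜ.indicator f x‖ₑ ^ 2 ∂unitMeasure ≤
      ENNReal.ofReal t * rearrangement f t ^ 2 +
        ∫⁻ u in Ico t 1, rearrangement f u ^ 2 := by
  have h := lintegral_comp_enorm_eq_rearrangement hf
    (g := (Iic (rearrangement f t)).indicator (fun y => y ^ 2))
    ((measurable_id.pow_const 2).indicator measurableSet_Iic)
  have h1 : ∀ x, ‖{x | rearrangement f t < ‖f x‖ₑ}ᶜ.indicator f x‖ₑ ^ 2 =
      (Iic (rearrangement f t)).indicator (fun y => y ^ 2) ‖f x‖ₑ := by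
    intro x
    by_cases hx : rearrangement f t < ‖f x‖ₑ
    · simp [indicator, hx]
    · simp [indicator, hx, not_lt.1 hx]
  simp_rw [h1]
  rw [h, ← Ioo_union_Ico_eq_Ioo ht0 ht]
  refine (lintegral_union_le _ _ _).trans (add_le_add ?_ ?_)
  · calc _ ≤ ∫⁻ _ in Ioo 0 t, rearrangement f t ^ 2 := by
          refine lintegral_mono fun u => ?_
          by_cases hu : rearrangement f u ≤ rearrangement f t
          · rw [indicator_of_mem (s := Iic _) hu]
            exact pow_le_pow_left' hu 2
          · rw [indicator_of_notMem (s := Iic _) hu]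
            exact zero_le
      _ = _ := by simp [mul_comm]
  · exact lintegral_mono fun u => indicator_le_self _ _ _

theorem setLIntegral_rpow_neg_half {t : ℝ} (ht : 0 ≤ t) :
    ∫⁻ u in Ioo 0 t, ENNReal.ofReal (u ^ (-(1 / 2) : ℝ)) = ENNReal.ofReal (2 * t ^ (1 / 2 : ℝ)) := by
  have hi : IntegrableOn (fun u : ℝ => u ^ (-(1 / 2) : ℝ)) (Ioo 0 t) := by
    have := intervalIntegral.intervalIntegrable_rpow' (a := 0) (b := t)
      (r := -(1 / 2)) (by norm_num)
    exact ((intervalIntegrable_iff_integrableOn_Ioc_of_le ht).1 this).mono_set Ioo_subset_Ioc_self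
  rw [← ofReal_integral_eq_lintegral_ofReal hi]
  · rw [← integral_Ioc_eq_integral_Ioo, ← intervalIntegral.integral_of_le ht,
      integral_rpow (Or.inl (by norm_num))]
    congr 1
    norm_num
    ring
  · refine (ae_restrict_iff' measurableSet_Ioo).2 (.of_forall fun u hu => ?_)
    exact Real.rpow_nonneg hu.1.le _

/-- Cauchy–Schwarz for `g = u^(-1/4) · u^(1/4) g`. The unweighted version would lose the factor
`√u`, the source of the damping near `0`. -/
theorem sq_setLIntegral_le {g : ℝ → ℝ≥0∞} (hg : Measurable g) {t : ℝ} (ht : 0 ≤ t) :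
    (∫⁻ u in Ioo 0 t, g u) ^ 2 ≤ ENNReal.ofReal (2 * t ^ (1 / 2 : ℝ)) *
      ∫⁻ u in Ioo 0 t, ENNReal.ofReal (u ^ (1 / 2 : ℝ)) * g u ^ 2 := by
  have hm1 : Measurable fun u : ℝ => ENNReal.ofReal (u ^ (-(1 / 2) : ℝ)) := by fun_prop
  have hm2 : Measurable fun u : ℝ => ENNReal.ofReal (u ^ (1 / 2 : ℝ)) * g u ^ 2 := by fun_prop
  have h := ENNReal.lintegral_mul_norm_pow_le (μ := volume.restrict (Ioo 0 t))
    hm1.aemeasurable hm2.aemeasurable (p := 1 / 2) (q := 1 / 2) (by norm_num) (by norm_num)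
    (by norm_num)
  have h2 : ∫⁻ u in Ioo 0 t, ENNReal.ofReal (u ^ (-(1 / 2) : ℝ)) ^ (1 / 2 : ℝ) *
      (ENNReal.ofReal (u ^ (1 / 2 : ℝ)) * g u ^ 2) ^ (1 / 2 : ℝ) = ∫⁻ u in Ioo 0 t, g u := by
    refine setLIntegral_congr_fun measurableSet_Ioo fun u hu => ?_
    rw [← ENNReal.mul_rpow_of_nonneg _ _ (by norm_num), ← mul_assoc,
      ← ENNReal.ofReal_mul (Real.rpow_nonneg hu.1.le _), ← Real.rpow_add hu.1]
    norm_num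
    rw [← ENNReal.rpow_natCast, ← ENNReal.rpow_mul]
    norm_num
  rw [h2, setLIntegral_rpow_neg_half ht] at h
  calc _ ≤ _ := pow_le_pow_left' h 2
    _ = _ := by
      rw [← ENNReal.mul_rpow_of_nonneg _ _ (by norm_num), ← ENNReal.rpow_natCast,
        ← ENNReal.rpow_mul]
      norm_num

end Rearrangement

/-! ### Rearrangement of families and its `l_2` norm. -/

section Sequence

variable {ι : Type*}

theorem seqRearrangement_le_add {a b c : ι → ℂ} {D : ℝ≥0∞} (h : ∀ n, c n = a n + b n)
    (hb : ∀ n, ‖b n‖ₑ ≤ D) (k : ℕ) : seqRearrangement c k ≤ seqRearrangement a k + D := by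
  rw [seqRearrangement, seqRearrangement, ENNReal.sInf_add]
  refine le_iInf₂ fun s hs => sInf_le ?_
  refine lt_of_le_of_lt (encard_le_encard fun n hn => ?_) hs
  rw [mem_ofPred_eq] at hn ⊢
  by_contra! hc
  refine absurd hn (not_lt.2 ?_)
  rw [h n]
  exact (enorm_add_le _ _).trans (add_le_add hc (hb n))

/-- If `c_{j+1}^* > s`, then at least `j + 1` of the `|c n|` exceed `s`; hence all such `j` lie
below that number. This half of equimeasurability suffices. -/
theorem count_lt_seqRearrangement_le (c : ι → ℂ) (s : ℝ≥0∞) :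
    {j : ℕ | s < seqRearrangement c (j + 1)}.encard ≤ {n | s < ‖c n‖ₑ}.encard := by
  have hsub : ∀ j ∈ {j : ℕ | s < seqRearrangement c (j + 1)},
      ((j + 1 : ℕ) : ℕ∞) ≤ {n | s < ‖c n‖ₑ}.encard := by
    intro j hj
    by_contra! hc
    exact absurd (sInf_le (a := s) hc) (not_le.2 hj)
  generalize {n | s < ‖c n‖ₑ}.encard = E at hsub ⊢
  induction E using ENat.recTopCoe with
  | top => exact le_top
  | coe e =>
    have : {j : ℕ | s < seqRearrangement c (j + 1)} ⊆ (Finset.range e : Finset ℕ) := by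
      intro j hj
      have := hsub j hj
      norm_cast at this
      simpa using this
    refine (encard_le_encard this).trans ?_
    rw [encard_coe_eq_coe_finsetCard, Finset.card_range]

theorem seqRearrangement_le_of_le {c : ι → ℂ} {B : ℝ≥0∞} (h : ∀ n, ‖c n‖ₑ ≤ B) {k : ℕ}
    (hk : 0 < k) : seqRearrangement c k ≤ B := by
  refine sInf_le ?_
  have : {n | B < ‖c n‖ₑ} = ∅ := by
    ext n
    simpa using h n
  simpa [this] using hk

/-- Layer-cake formula for counting measure; it reduces comparing sums of squares to comparing the
counts of large terms. -/
theorem tsum_sq_eq_lintegral_encard {a : ι → ℝ≥0∞} (ha : ∀ i, a i ≠ ⊤) :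
    ∑' i, a i ^ 2 = ∫⁻ t in Ioi (0 : ℝ),
      (({i | ENNReal.ofReal (√t) < a i}.encard : ℕ∞) : ℝ≥0∞) := by
  let _ : MeasurableSpace ι := ⊤
  have : DiscreteMeasurableSpace ι := ⟨fun _ => trivial⟩
  have h := lintegral_eq_lintegral_meas_lt (Measure.count : Measure ι)
    (f := fun i => (a i).toReal ^ 2) (.of_forall fun i => sq_nonneg _)
    (Measurable.of_discrete).aemeasurable
  rw [lintegral_count] at h
  have h1 : ∀ i, ENNReal.ofReal ((a i).toReal ^ 2) = a i ^ 2 := fun i => by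
    rw [ENNReal.ofReal_pow ENNReal.toReal_nonneg, ENNReal.ofReal_toReal (ha i)]
  simp_rw [h1] at h
  rw [h]
  refine setLIntegral_congr_fun measurableSet_Ioi fun t ht => ?_
  rw [Measure.count_apply (MeasurableSet.of_discrete)]
  congr 3
  ext i
  rw [ENNReal.ofReal_lt_iff_lt_toReal (Real.sqrt_nonneg _) (ha i),
    Real.sqrt_lt (le_of_lt ht) ENNReal.toReal_nonneg]

theorem tsum_seqRearrangement_sq_le (c : ι → ℂ) :
    ∑' j : ℕ, seqRearrangement c (j + 1) ^ 2 ≤ ∑' n, ‖c n‖ₑ ^ 2 := by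
  by_cases hS : ∑' n, ‖c n‖ₑ ^ 2 = ⊤
  · rw [hS]; exact le_top
  have hfin : ∀ j : ℕ, seqRearrangement c (j + 1) ≠ ⊤ := by
    intro j
    have hb : ∀ n, ‖c n‖ₑ ≤ (∑' n, ‖c n‖ₑ ^ 2) ^ (1 / 2 : ℝ) := fun n => by
      calc ‖c n‖ₑ = (‖c n‖ₑ ^ 2) ^ (1 / 2 : ℝ) := by
            rw [← ENNReal.rpow_natCast, ← ENNReal.rpow_mul]; norm_num
        _ ≤ _ := ENNReal.rpow_le_rpow (ENNReal.le_tsum n) (by norm_num)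
    exact ne_top_of_le_ne_top (ENNReal.rpow_ne_top_of_nonneg (by norm_num) hS)
      (seqRearrangement_le_of_le hb j.succ_pos)
  rw [tsum_sq_eq_lintegral_encard hfin,
    tsum_sq_eq_lintegral_encard (a := fun n => ‖c n‖ₑ) fun n => enorm_ne_top]
  exact lintegral_mono fun t => ENat.toENNReal_le.2 (count_lt_seqRearrangement_le c _)

end Sequence

/-! ### Logarithmic weights as sums over dyadic levels. -/

section DyadicWeights

/-- The logarithmic weight at the dyadic level `2 ^ i`. -/
noncomputable def dyadicWeight (g : ℝ) (i : ℕ) : ℝ := (1 + (i : ℝ)) ^ (-g)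

theorem dyadicWeight_nonneg (g : ℝ) (i : ℕ) : 0 ≤ dyadicWeight g i :=
  Real.rpow_nonneg (by positivity) _

theorem dyadicWeight_antitone {g : ℝ} (hg : 0 < g) : Antitone (dyadicWeight g) := by
  intro i j hij
  exact Real.rpow_le_rpow_of_nonpos (by positivity) (by gcongr) (by linarith)

/-- The increments of the logarithmic weight. -/
noncomputable def dyadicIncrement (g : ℝ) (i : ℕ) : ℝ := dyadicWeight g i - dyadicWeight g (i + 1)

theorem dyadicIncrement_nonneg {g : ℝ} (hg : 0 < g) (i : ℕ) : 0 ≤ dyadicIncrement g i :=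
  sub_nonneg.2 (dyadicWeight_antitone hg i.le_succ)

theorem tendsto_dyadicWeight {g : ℝ} (hg : 0 < g) :
    Filter.Tendsto (dyadicWeight g) Filter.atTop (nhds 0) :=
  (tendsto_rpow_neg_atTop hg).comp
    (Filter.tendsto_atTop_add_const_left _ _ tendsto_natCast_atTop_atTop)

theorem hasSum_dyadicIncrement {g : ℝ} (hg : 0 < g) (m : ℕ) :
    HasSum (fun i => dyadicIncrement g (m + i)) (dyadicWeight g m) := by
  rw [hasSum_iff_tendsto_nat_of_nonneg fun i => dyadicIncrement_nonneg hg _]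
  have h : ∀ n, ∑ i ∈ Finset.range n, dyadicIncrement g (m + i)
      = dyadicWeight g m - dyadicWeight g (m + n) := fun n =>
    Finset.sum_range_sub' (fun i => dyadicWeight g (m + i)) n
  simp_rw [h]
  simpa using tendsto_const_nhds.sub ((tendsto_dyadicWeight hg).comp
    (Filter.tendsto_atTop_mono (fun n => Nat.le_add_left n m) Filter.tendsto_id))

/-- This is `1 + m ≤ (1 + i)(1 + (m - i))` raised to the power `g`. -/
theorem dyadicWeight_le_mul {g : ℝ} (hg : 0 < g) {i m : ℕ} (him : i ≤ m) :
    dyadicWeight g i ≤ dyadicWeight g m * (1 + ((m - i : ℕ) : ℝ)) ^ g := by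
  have h : (1 + (m : ℝ)) ≤ (1 + (i : ℝ)) * (1 + ((m - i : ℕ) : ℝ)) := by
    rw [Nat.cast_sub him]
    have : (i : ℝ) ≤ m := by exact_mod_cast him
    nlinarith [mul_nonneg (Nat.cast_nonneg (α := ℝ) i) (sub_nonneg.2 this)]
  have h1 := Real.rpow_le_rpow (by positivity) h hg.le
  rw [Real.mul_rpow (by positivity) (by positivity)] at h1
  rw [dyadicWeight, dyadicWeight, Real.rpow_neg (by positivity), Real.rpow_neg (by positivity),
    inv_mul_eq_div, le_div_iff₀ (by positivity), inv_mul_le_iff₀ (by positivity)]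
  exact h1

theorem summable_rpow_mul_geometric (g : ℝ) {r : ℝ} (hr0 : 0 < r) (hr : r < 1) :
    Summable fun l : ℕ => (1 + (l : ℝ)) ^ g * r ^ l := by
  have h := (summable_nat_add_iff 1).2 (summable_pow_mul_geometric_of_norm_lt_one (R := ℝ) ⌈g⌉₊
    (r := r) (by rwa [Real.norm_of_nonneg hr0.le]))
  refine Summable.of_nonneg_of_le (fun l => by positivity) (fun l => ?_) (h.mul_left r⁻¹)
  have h1 : (1 + (l : ℝ)) ^ g ≤ (1 + (l : ℝ)) ^ ⌈g⌉₊ := by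
    rw [← Real.rpow_natCast]
    exact Real.rpow_le_rpow_of_exponent_le (by linarith [Nat.cast_nonneg (α := ℝ) l])
      (Nat.le_ceil g)
  calc _ ≤ (1 + (l : ℝ)) ^ ⌈g⌉₊ * r ^ l := by gcongr
    _ = _ := by push_cast; rw [pow_succ]; field_simp; ring

/-- The sum which controls the low dyadic levels. -/
noncomputable def lowLevelConst (g : ℝ) : ℝ := ∑' l : ℕ, (1 + (l : ℝ)) ^ g * (√2)⁻¹ ^ l

theorem lowLevelConst_nonneg (g : ℝ) : 0 ≤ lowLevelConst g := tsum_nonneg fun _ => by positivity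

/-- Going down `l = m - i` levels, the weight grows only polynomially in `l`, which the geometric
factor `2^(-l/2)` absorbs. -/
theorem sum_dyadicIncrement_mul_le {g : ℝ} (hg : 0 < g) (m : ℕ) :
    ∑ i ∈ Finset.range m, dyadicIncrement g i * (√2)⁻¹ ^ (m - i) ≤
      lowLevelConst g * dyadicWeight g m := by
  have hs : Summable fun l : ℕ => (1 + (l : ℝ)) ^ g * (√2)⁻¹ ^ l :=
    summable_rpow_mul_geometric g (by positivity)
      (inv_lt_one_of_one_lt₀ (by rw [Real.lt_sqrt] <;> norm_num))
  calc _ ≤ ∑ i ∈ Finset.range m, dyadicWeight g m *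
        ((1 + ((m - i : ℕ) : ℝ)) ^ g * (√2)⁻¹ ^ (m - i)) := by
        refine Finset.sum_le_sum fun i hi => ?_
        rw [← mul_assoc]
        refine mul_le_mul_of_nonneg_right ?_ (by positivity)
        refine le_trans ?_ (dyadicWeight_le_mul hg (Finset.mem_range.1 hi).le)
        have := dyadicWeight_nonneg g (i + 1)
        rw [dyadicIncrement]
        linarith
    _ ≤ dyadicWeight g m * lowLevelConst g := by
        rw [← Finset.mul_sum]
        refine mul_le_mul_of_nonneg_left ?_ (dyadicWeight_nonneg g m)
        have hinj : Set.InjOn (fun i => m - i) (Finset.range m : Set ℕ) := by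
          intro a ha b hb hab
          simp only [Finset.coe_range, mem_Iio] at ha hb hab
          omega
        have := Finset.sum_image (s := Finset.range m) (g := fun i => m - i)
          (f := fun l : ℕ => (1 + (l : ℝ)) ^ g * (√2)⁻¹ ^ l) hinj
        rw [← this]
        exact hs.sum_le_tsum _ fun _ _ => by positivity
    _ = _ := mul_comm _ _

theorem rpow_one_add_log_le_dyadicWeight {g : ℝ} (hg : 0 < g) {J : ℝ} (hJ : 1 ≤ J) {m : ℕ}
    (hJm : (2 : ℝ) ^ m ≤ 2 * J) :
    (1 + Real.log J) ^ (-g) ≤ 2 ^ g * dyadicWeight g m := by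
  have hlog : 0 ≤ Real.log J := Real.log_nonneg hJ
  have h := Real.log_le_log (by positivity) hJm
  rw [Real.log_pow, Real.log_mul (by norm_num) (by linarith)] at h
  have hl2 := Real.log_two_gt_d9
  have hl2' := Real.log_two_lt_d9
  have h1 : (1 + (m : ℝ)) / 2 ≤ 1 + Real.log J := by nlinarith [Nat.cast_nonneg (α := ℝ) m]
  calc _ ≤ ((1 + (m : ℝ)) / 2) ^ (-g) :=
        Real.rpow_le_rpow_of_nonpos (by positivity) h1 (by linarith)
    _ = _ := by
        rw [Real.div_rpow (by positivity) (by norm_num), dyadicWeight,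
          Real.rpow_neg (x := 2) (by norm_num), div_inv_eq_mul, mul_comm]

theorem dyadicWeight_le_rpow_one_add_log {g : ℝ} (hg : 0 < g) {J : ℝ} (hJ : 1 ≤ J) {m : ℕ}
    (hJm : J ≤ (2 : ℝ) ^ (m + 1)) :
    dyadicWeight g m ≤ 2 ^ g * (1 + Real.log J) ^ (-g) := by
  have hlog : 0 ≤ Real.log J := Real.log_nonneg hJ
  have h := Real.log_le_log (by linarith) hJm
  rw [Real.log_pow] at h
  push_cast at h
  have hl2' := Real.log_two_lt_d9
  have h1 : (1 + Real.log J) / 2 ≤ 1 + (m : ℝ) := by nlinarith [Nat.cast_nonneg (α := ℝ) m]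
  calc _ ≤ ((1 + Real.log J) / 2) ^ (-g) :=
        Real.rpow_le_rpow_of_nonpos (by positivity) h1 (by linarith)
    _ = _ := by
        rw [Real.div_rpow (by positivity) (by norm_num),
          Real.rpow_neg (x := 2) (by norm_num), div_inv_eq_mul, mul_comm]

/-- The partial sums `∑ v_i min(1, √(2^i / J))` decay like the logarithmic weight at `J`. -/
theorem sum_dyadicIncrement_min_le {g : ℝ} (hg : 0 < g) {J : ℝ} (hJ : 1 ≤ J) (n : ℕ) :
    ∑ i ∈ Finset.range n, dyadicIncrement g i * min 1 (√(2 ^ i / J)) ≤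
      (lowLevelConst g + 1) * 2 ^ g * (1 + Real.log J) ^ (-g) := by
  -- The sum is split at `2^m ≤ J < 2^(m+1)`. Below `m` the square root decays geometrically; from
  -- `m` on the minimum is at most `1` and the increments telescope.
  obtain ⟨m, hm, hm'⟩ := exists_nat_pow_near hJ (by norm_num : (1 : ℝ) < 2)
  have hterm : ∀ i, 0 ≤ dyadicIncrement g i * min 1 (√(2 ^ i / J)) := fun i =>
    mul_nonneg (dyadicIncrement_nonneg hg i) (le_min zero_le_one (Real.sqrt_nonneg _))
  have hlow : ∑ i ∈ Finset.range m, dyadicIncrement g i * min 1 (√(2 ^ i / J)) ≤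
      lowLevelConst g * dyadicWeight g m := by
    refine le_trans (Finset.sum_le_sum fun i hi => ?_) (sum_dyadicIncrement_mul_le hg m)
    refine mul_le_mul_of_nonneg_left ((min_le_right _ _).trans ?_) (dyadicIncrement_nonneg hg i)
    have him := (Finset.mem_range.1 hi).le
    rw [Real.sqrt_le_left (by positivity), ← pow_mul, mul_comm, pow_mul, inv_pow,
      Real.sq_sqrt (by norm_num), inv_pow, div_le_iff₀ (by linarith), inv_mul_eq_div,
      le_div_iff₀ (by positivity), ← pow_add, Nat.add_sub_cancel' him]
    exact hm
  have hhigh : ∑ i ∈ Finset.range n, dyadicIncrement g (m + i) * min 1 (√(2 ^ (m + i) / J)) ≤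
      dyadicWeight g m := by
    refine le_trans (Finset.sum_le_sum fun i _ => ?_) (sum_le_hasSum (Finset.range n)
      (fun i _ => dyadicIncrement_nonneg hg (m + i)) (hasSum_dyadicIncrement hg m))
    exact mul_le_of_le_one_right (dyadicIncrement_nonneg hg _) (min_le_left _ _)
  calc _ ≤ ∑ i ∈ Finset.range (m + n), dyadicIncrement g i * min 1 (√(2 ^ i / J)) :=
        Finset.sum_le_sum_of_subset_of_nonneg (by simp) fun i _ _ => hterm i
    _ ≤ (lowLevelConst g + 1) * dyadicWeight g m := by
        rw [Finset.sum_range_add]; linarith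
    _ ≤ _ := by
        rw [mul_assoc]
        exact mul_le_mul_of_nonneg_left (dyadicWeight_le_rpow_one_add_log hg hJ hm'.le)
          (by linarith [lowLevelConst_nonneg g])

/-- The constant in `tsum_dyadicIncrement_min_le`. -/
noncomputable def dyadicConst (g : ℝ) : ℝ := (lowLevelConst g + 1) * 2 ^ g

theorem dyadicConst_nonneg (g : ℝ) : 0 ≤ dyadicConst g :=
  mul_nonneg (by linarith [lowLevelConst_nonneg g]) (by positivity)

theorem sum_dyadicIncrement_min_le_log {g : ℝ} (hg : 0 < g) {N u : ℝ} (hN : 1 ≤ N)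
    (hu : u ∈ Ioo (0 : ℝ) 1) (n : ℕ) :
    ∑ i ∈ Finset.range n, dyadicIncrement g i * min 1 (√(u * (N * 2 ^ i))) ≤
      dyadicConst g * (1 + Real.log N) ^ g * (1 + |Real.log u|) ^ (-g) := by
  obtain ⟨hu0, hu1⟩ := hu
  have hlogN : 0 ≤ Real.log N := Real.log_nonneg hN
  have hlogu : Real.log u < 0 := Real.log_neg hu0 hu1
  rw [abs_of_neg hlogu]
  have hN0 : 0 < N := by linarith
  -- With `J = 1/(Nu) ≥ 1` one has `1 + |log u| = 1 + log N + log J ≤ (1 + log N)(1 + log J)`. If `J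
  -- < 1`, then `|log u| ≤ log N`, so the right side is at least `1`, while the increments sum to at
  -- most `1`.
  by_cases hJ : 1 ≤ 1 / (N * u)
  · have h := sum_dyadicIncrement_min_le hg hJ n
    have hlog : Real.log (1 / (N * u)) = -Real.log N - Real.log u := by
      rw [one_div, Real.log_inv, Real.log_mul hN0.ne' hu0.ne']
      ring
    have hJ0 : 0 ≤ Real.log (1 / (N * u)) := Real.log_nonneg hJ
    have heq : ∀ i : ℕ, u * (N * 2 ^ i) = 2 ^ i / (1 / (N * u)) := fun i => by
      field_simp
    simp_rw [heq]
    refine h.trans ?_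
    rw [mul_assoc (dyadicConst g)]
    refine mul_le_mul_of_nonneg_left ?_ (dyadicConst_nonneg g)
    rw [Real.rpow_neg (by linarith), Real.rpow_neg (by linarith), ← div_eq_mul_inv,
      le_div_iff₀ (Real.rpow_pos_of_pos (by linarith) _),
      inv_mul_le_iff₀ (Real.rpow_pos_of_pos (by linarith) _),
      ← Real.mul_rpow (by linarith) (by linarith)]
    refine Real.rpow_le_rpow (by linarith) ?_ hg.le
    nlinarith [mul_nonneg hlogN hJ0]
  · rw [not_le, div_lt_one (by positivity)] at hJ
    have hlog : -Real.log u ≤ Real.log N := by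
      have := Real.log_pos hJ
      rw [Real.log_mul hN0.ne' hu0.ne'] at this
      linarith
    have h1 : ∑ i ∈ Finset.range n, dyadicIncrement g i * min 1 (√(u * (N * 2 ^ i))) ≤ 1 := by
      have hW : dyadicWeight g 0 = 1 := by simp [dyadicWeight]
      have hs := hasSum_dyadicIncrement hg 0
      rw [hW] at hs
      simp only [zero_add] at hs
      refine le_trans (Finset.sum_le_sum fun i _ => ?_) (sum_le_hasSum (Finset.range n)
        (fun i _ => dyadicIncrement_nonneg hg i) hs)
      exact mul_le_of_le_one_right (dyadicIncrement_nonneg hg _) (min_le_left _ _)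
    refine h1.trans ?_
    have hC : 1 ≤ dyadicConst g := one_le_mul_of_one_le_of_one_le
      (by linarith [lowLevelConst_nonneg g]) (Real.one_le_rpow (by norm_num) hg.le)
    rw [mul_assoc]
    refine one_le_mul_of_one_le_of_one_le hC ?_
    rw [Real.rpow_neg (by linarith), ← div_eq_mul_inv,
      le_div_iff₀ (Real.rpow_pos_of_pos (by linarith) _), one_mul]
    exact Real.rpow_le_rpow (by linarith) (by linarith) hg.le

theorem tsum_dyadicIncrement_min_le_log {g : ℝ} (hg : 0 < g) {N u : ℝ} (hN : 1 ≤ N)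
    (hu : u ∈ Ioo (0 : ℝ) 1) :
    ∑' i : ℕ, ENNReal.ofReal (dyadicIncrement g i) *
        ENNReal.ofReal (min 1 (√(u * (N * 2 ^ i)))) ≤
      ENNReal.ofReal (dyadicConst g * (1 + Real.log N) ^ g) *
        ENNReal.ofReal ((1 + |Real.log u|) ^ (-g)) := by
  have hlogN : 0 ≤ Real.log N := Real.log_nonneg hN
  refine ENNReal.tsum_le_of_sum_range_le fun n => ?_
  simp_rw [← ENNReal.ofReal_mul (dyadicIncrement_nonneg hg _)]
  rw [← ENNReal.ofReal_sum_of_nonneg fun i _ => mul_nonneg (dyadicIncrement_nonneg hg i)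
    (le_min zero_le_one (Real.sqrt_nonneg _)),
    ← ENNReal.ofReal_mul (mul_nonneg (dyadicConst_nonneg g) (by positivity))]
  exact ENNReal.ofReal_le_ofReal (sum_dyadicIncrement_min_le_log hg hN hu n)

/-- Abel summation over dyadic blocks. -/
theorem tsum_log_weight_mul_le {g : ℝ} (hg : 0 < g) (a : ℕ → ℝ≥0∞) :
    ∑' j : ℕ, ENNReal.ofReal ((1 + Real.log ((j + 1 : ℕ) : ℝ)) ^ (-g)) * a j ≤
      ENNReal.ofReal (2 ^ g) * ∑' i : ℕ, ENNReal.ofReal (dyadicIncrement g i) *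
        ∑ j ∈ Finset.range (2 ^ i), a j := by
  have hweight : ∀ j : ℕ, ENNReal.ofReal ((1 + Real.log ((j + 1 : ℕ) : ℝ)) ^ (-g)) ≤
      ENNReal.ofReal (2 ^ g) * ∑' i : ℕ, if j < 2 ^ i then
        ENNReal.ofReal (dyadicIncrement g i) else 0 := by
    intro j
    -- The least `m` with `j + 1 < 2^m`: every level `i ≥ m` contains `j`, and the tail of
    -- increments from `m` equals the weight at `m`.
    set m := Nat.log 2 (j + 1) + 1 with hm
    have hm1 : (2 : ℝ) ^ m ≤ 2 * ((j + 1 : ℕ) : ℝ) := by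
      have := Nat.pow_log_le_self 2 (x := j + 1) (by omega)
      rw [hm, pow_succ, mul_comm]
      gcongr
      exact_mod_cast this
    have hm2 : j + 1 < 2 ^ m := Nat.lt_pow_succ_log_self (by norm_num) _
    have h1 := rpow_one_add_log_le_dyadicWeight hg (J := ((j + 1 : ℕ) : ℝ))
      (by exact_mod_cast Nat.succ_pos j) hm1
    refine (ENNReal.ofReal_le_ofReal h1).trans ?_
    rw [ENNReal.ofReal_mul (by positivity)]
    refine mul_le_mul_right ?_ _
    rw [← (hasSum_dyadicIncrement hg m).tsum_eq,
      ENNReal.ofReal_tsum_of_nonneg (fun i => dyadicIncrement_nonneg hg _)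
        (hasSum_dyadicIncrement hg m).summable]
    have hinj : Function.Injective fun i => m + i := add_right_injective m
    refine le_trans (ENNReal.tsum_le_tsum fun i => ?_) (ENNReal.tsum_comp_le_tsum_of_injective hinj
      (fun i => if j < 2 ^ i then ENNReal.ofReal (dyadicIncrement g i) else 0))
    have : j < 2 ^ (m + i) :=
      (Nat.lt_of_succ_lt hm2).trans_le (Nat.pow_le_pow_right (by norm_num) (Nat.le_add_right m i))
    simp [this]
  calc _ ≤ ∑' j : ℕ, (ENNReal.ofReal (2 ^ g) * ∑' i : ℕ, if j < 2 ^ i then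
        ENNReal.ofReal (dyadicIncrement g i) else 0) * a j :=
        ENNReal.tsum_le_tsum fun j => mul_le_mul_left (hweight j) _
    _ = ENNReal.ofReal (2 ^ g) * ∑' (j : ℕ) (i : ℕ), (if j < 2 ^ i then
        ENNReal.ofReal (dyadicIncrement g i) else 0) * a j := by
        simp_rw [mul_assoc, ENNReal.tsum_mul_left, ENNReal.tsum_mul_right]
    _ = _ := by
        rw [ENNReal.tsum_comm]
        congr 2
        ext i
        rw [Finset.mul_sum, tsum_eq_sum (s := Finset.range (2 ^ i))]
        · exact Finset.sum_congr rfl fun j hj => by rw [if_pos (Finset.mem_range.1 hj)]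
        · intro j hj
          rw [if_neg (by simpa using hj), zero_mul]

end DyadicWeights

/-! ### Both parts of the truncation are controlled by the damped energy. -/

section Truncation

/-- The energy of the rearrangement, damped below the level `t`. -/
noncomputable def dampedEnergy (f : ℝ → ℂ) (t : ℝ) : ℝ≥0∞ :=
  ∫⁻ u in Ioo (0 : ℝ) 1, ENNReal.ofReal (min 1 (√(u / t))) * rearrangement f u ^ 2

theorem setLIntegral_Ico_sq_le_dampedEnergy (f : ℝ → ℂ) {t : ℝ} (ht : 0 < t) :
    ∫⁻ u in Ico t 1, rearrangement f u ^ 2 ≤ dampedEnergy f t := by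
  have hsub : Ico t 1 ⊆ Ioo (0 : ℝ) 1 := fun u hu => ⟨ht.trans_le hu.1, hu.2⟩
  refine le_trans (le_of_eq ?_) (lintegral_mono_set hsub)
  refine setLIntegral_congr_fun measurableSet_Ico fun u hu => ?_
  have : 1 ≤ √(u / t) := by
    rw [Real.one_le_sqrt, one_le_div ht]
    exact hu.1
  simp [min_eq_left this]

theorem sq_setLIntegral_le_dampedEnergy (f : ℝ → ℂ) {t : ℝ} (ht : 0 < t) (ht1 : t ≤ 1) :
    (∫⁻ u in Ioo 0 t, rearrangement f u) ^ 2 ≤ ENNReal.ofReal (2 * t) * dampedEnergy f t := by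
  have hsub : Ioo 0 t ⊆ Ioo (0 : ℝ) 1 := Ioo_subset_Ioo_right ht1
  have h : ∫⁻ u in Ioo 0 t, ENNReal.ofReal (u ^ (1 / 2 : ℝ)) * rearrangement f u ^ 2 ≤
      ENNReal.ofReal (√t) * dampedEnergy f t := by
    refine le_trans (le_of_eq ?_) (mul_le_mul_right (lintegral_mono_set hsub) _)
    rw [← lintegral_const_mul' _ _ ENNReal.ofReal_ne_top]
    refine setLIntegral_congr_fun measurableSet_Ioo fun u hu => ?_
    have h1 : √(u / t) ≤ 1 := by
      rw [Real.sqrt_le_left zero_le_one, one_pow, div_le_one ht]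
      exact hu.2.le
    rw [min_eq_right h1, ← mul_assoc, ← ENNReal.ofReal_mul (Real.sqrt_nonneg _),
      ← Real.sqrt_mul ht.le, mul_div_cancel₀ _ ht.ne', Real.sqrt_eq_rpow]
  calc _ ≤ _ := sq_setLIntegral_le (measurable_rearrangement f) ht.le
    _ ≤ _ := mul_le_mul_right h _
    _ = _ := by
      rw [← mul_assoc, ← ENNReal.ofReal_mul (by positivity), ← Real.sqrt_eq_rpow, mul_assoc,
        Real.mul_self_sqrt ht.le]

/-- Monotonicity gives `t f^*(t) ≤ ∫_0^t f^*`; square, apply the previous bound and cancel one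
factor `t`. -/
theorem mul_rearrangement_sq_le_dampedEnergy (f : ℝ → ℂ) {t : ℝ} (ht : 0 < t) (ht1 : t ≤ 1) :
    ENNReal.ofReal t * rearrangement f t ^ 2 ≤ 2 * dampedEnergy f t := by
  have h : ENNReal.ofReal t * rearrangement f t ≤ ∫⁻ u in Ioo 0 t, rearrangement f u := by
    calc _ = ∫⁻ _ in Ioo 0 t, rearrangement f t := by simp [mul_comm]
      _ ≤ _ := setLIntegral_mono (measurable_rearrangement f)
        fun u hu => rearrangement_antitone f hu.2.le
  have h2 := (pow_le_pow_left' h 2).trans (sq_setLIntegral_le_dampedEnergy f ht ht1)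
  have ht0 : ENNReal.ofReal t ≠ 0 := by simpa using ht
  refine (ENNReal.mul_le_mul_iff_right ht0 ENNReal.ofReal_ne_top).1 ?_
  calc _ = (ENNReal.ofReal t * rearrangement f t) ^ 2 := by ring
    _ ≤ _ := h2
    _ = _ := by
      rw [ENNReal.ofReal_mul (by norm_num)]
      norm_num
      ring

theorem lintegral_enorm_sq_indicator_compl_le_dampedEnergy {f : ℝ → ℂ}
    (hf : AEStronglyMeasurable f unitMeasure) {t : ℝ} (ht : 0 < t) (ht1 : t ≤ 1) :
    ∫⁻ x, ‖{x | rearrangement f t < ‖f x‖ₑ}ᶜ.indicator f x‖ₑ ^ 2 ∂unitMeasure ≤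
      3 * dampedEnergy f t := by
  calc _ ≤ _ := lintegral_enorm_sq_indicator_compl_le hf ht ht1
    _ ≤ 2 * dampedEnergy f t + dampedEnergy f t :=
      add_le_add (mul_rearrangement_sq_le_dampedEnergy f ht ht1)
        (setLIntegral_Ico_sq_le_dampedEnergy f ht)
    _ = _ := by ring

end Truncation

/-! ### Fourier coefficients of the two parts: Bessel and the uniform bound. -/

section Fourier

variable {ι : Type*} {φ : ι → Lp ℂ 2 unitMeasure}

theorem enorm_fourierMap_le {M : ℝ} (hM : ∀ n, ∀ᵐ x ∂unitMeasure, ‖φ n x‖ₑ ≤ ENNReal.ofReal M)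
    (f : ℝ → ℂ) (n : ι) :
    ‖fourierMap φ f n‖ₑ ≤ ENNReal.ofReal M * ∫⁻ x, ‖f x‖ₑ ∂unitMeasure := by
  refine (enorm_integral_le_lintegral_enorm _).trans ?_
  rw [← lintegral_const_mul' _ _ ENNReal.ofReal_ne_top]
  refine lintegral_mono_ae ((hM n).mono fun x hx => ?_)
  rw [enorm_mul, RCLike.enorm_conj, mul_comm]
  exact mul_le_mul_left hx _

theorem integrable_mul_conj {M : ℝ} (hM : ∀ n, ∀ᵐ x ∂unitMeasure, ‖φ n x‖ₑ ≤ ENNReal.ofReal M)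
    (hM0 : 0 ≤ M) {f : ℝ → ℂ} (hf : Integrable f unitMeasure) (n : ι) :
    Integrable (fun x => f x * conj (φ n x)) unitMeasure := by
  refine hf.mul_bdd (c := M) ?_ ((hM n).mono fun x hx => ?_)
  · exact Complex.continuous_conj.comp_aestronglyMeasurable (Lp.aestronglyMeasurable (φ n))
  · rw [RCLike.norm_conj]
    rwa [← ofReal_norm, ENNReal.ofReal_le_ofReal_iff hM0] at hx

theorem tsum_enorm_fourierMap_sq_le (hφ : Orthonormal ℂ φ) {f : ℝ → ℂ}
    (hf : AEStronglyMeasurable f unitMeasure) :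
    ∑' n, ‖fourierMap φ f n‖ₑ ^ 2 ≤ ∫⁻ x, ‖f x‖ₑ ^ 2 ∂unitMeasure := by
  by_cases hfin : ∫⁻ x, ‖f x‖ₑ ^ 2 ∂unitMeasure = ⊤
  · rw [hfin]; exact le_top
  have hnorm : eLpNorm f 2 unitMeasure ^ 2 = ∫⁻ x, ‖f x‖ₑ ^ 2 ∂unitMeasure := by
    rw [eLpNorm_eq_lintegral_rpow_enorm_toReal (by norm_num) (by norm_num),
      ← ENNReal.rpow_natCast, ← ENNReal.rpow_mul]
    norm_num
  have hmem : MemLp f 2 unitMeasure := by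
    refine ⟨hf, lt_top_iff_ne_top.2 fun h => hfin ?_⟩
    rw [← hnorm, h]
    norm_num
  have hcoef : ∀ n, fourierMap φ f n = inner ℂ (φ n) (hmem.toLp f) := by
    intro n
    rw [L2.inner_def, fourierMap]
    refine integral_congr_ae (hmem.coeFn_toLp.mono fun x hx => ?_)
    simp only [RCLike.inner_apply, hx]
  have hb := hφ.tsum_inner_products_le (hmem.toLp f)
  have hs := hφ.inner_products_summable (hmem.toLp f)
  calc ∑' n, ‖fourierMap φ f n‖ₑ ^ 2
      = ∑' n, ENNReal.ofReal (‖inner ℂ (φ n) (hmem.toLp f)‖ ^ 2) := by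
        refine tsum_congr fun n => ?_
        rw [hcoef, ENNReal.ofReal_pow (norm_nonneg _), ofReal_norm]
    _ = ENNReal.ofReal (∑' n, ‖inner ℂ (φ n) (hmem.toLp f)‖ ^ 2) :=
        (ENNReal.ofReal_tsum_of_nonneg (fun n => sq_nonneg _) hs).symm
    _ ≤ ENNReal.ofReal (‖hmem.toLp f‖ ^ 2) := ENNReal.ofReal_le_ofReal hb
    _ = _ := by
        rw [ENNReal.ofReal_pow (norm_nonneg _), Lp.norm_toLp,
          ENNReal.ofReal_toReal hmem.eLpNorm_ne_top, hnorm]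

theorem integrable_indicator_of_dampedEnergy_ne_top {f : ℝ → ℂ}
    (hf : AEStronglyMeasurable f unitMeasure) {t : ℝ} (ht : 0 < t) (ht1 : t ≤ 1)
    (hE : dampedEnergy f t ≠ ⊤) :
    Integrable ({x | rearrangement f t < ‖f x‖ₑ}.indicator f) unitMeasure ∧
      Integrable ({x | rearrangement f t < ‖f x‖ₑ}ᶜ.indicator f) unitMeasure := by
  have hS : NullMeasurableSet {x | rearrangement f t < ‖f x‖ₑ} unitMeasure :=
    nullMeasurableSet_lt aemeasurable_const hf.enorm
  constructor
  · refine ⟨hf.indicator₀ hS, (lintegral_enorm_indicator_gt_le hf ht1).trans_lt ?_⟩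
    rw [lt_top_iff_ne_top]
    intro h
    have := sq_setLIntegral_le_dampedEnergy f ht ht1
    rw [h, ENNReal.top_pow (by norm_num), top_le_iff] at this
    exact ENNReal.mul_ne_top ENNReal.ofReal_ne_top hE this
  · have hmem : MemLp ({x | rearrangement f t < ‖f x‖ₑ}ᶜ.indicator f) 2 unitMeasure := by
      refine ⟨hf.indicator₀ hS.compl, ?_⟩
      rw [eLpNorm_lt_top_iff_lintegral_rpow_enorm_lt_top (by norm_num) (by norm_num)]
      refine lt_of_le_of_lt ?_ (ENNReal.mul_ne_top (by norm_num : (3 : ℝ≥0∞) ≠ ⊤) hE).lt_top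
      refine le_trans (le_of_eq ?_)
        (lintegral_enorm_sq_indicator_compl_le_dampedEnergy hf ht ht1)
      norm_num
    exact hmem.integrable (by norm_num)

theorem add_sq_le_two_mul (a b : ℝ≥0∞) : (a + b) ^ 2 ≤ 2 * (a ^ 2 + b ^ 2) := by
  have := ENNReal.rpow_add_le_mul_rpow_add_rpow a b (p := 2) (by norm_num)
  norm_num at this
  exact this

theorem sum_range_seqRearrangement_sq_le (hφ : Orthonormal ℂ φ) {M N : ℝ} (hM0 : 0 ≤ M)
    (hM : ∀ n, ∀ᵐ x ∂unitMeasure, ‖φ n x‖ₑ ≤ ENNReal.ofReal M) (hN : 1 ≤ N) (hMN : M ^ 2 ≤ N)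
    {f : ℝ → ℂ} (hf : AEStronglyMeasurable f unitMeasure) {j : ℕ} (hj : 0 < j) :
    ∑ k ∈ Finset.range j, seqRearrangement (fourierMap φ f) (k + 1) ^ 2 ≤
      10 * dampedEnergy f (1 / (N * j)) := by
  by_cases hE : dampedEnergy f (1 / (N * j)) = ⊤
  · rw [hE, ENNReal.mul_top (by norm_num)]
    exact le_top
  have hj1 : (1 : ℝ) ≤ j := by exact_mod_cast hj
  have hNj : 1 ≤ N * j := one_le_mul_of_one_le_of_one_le hN hj1
  -- This level balances the two parts: `j` copies of the squared uniform bound cost `jM² · 2t ≤ 2`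
  -- energies. With the `3` from Bessel and the factor `2` of `add_sq_le_two_mul`, the constant is
  -- `2(3 + 2) = 10`.
  obtain ⟨t, ht⟩ : ∃ t, t = 1 / (N * j) := ⟨_, rfl⟩
  have ht0 : 0 < t := by rw [ht]; positivity
  have ht1 : t ≤ 1 := by
    rw [ht, div_le_one (by positivity)]
    exact hNj
  rw [← ht] at hE ⊢
  have hS : NullMeasurableSet {x | rearrangement f t < ‖f x‖ₑ} unitMeasure :=
    nullMeasurableSet_lt aemeasurable_const hf.enorm
  obtain ⟨hi1, hi0⟩ := integrable_indicator_of_dampedEnergy_ne_top hf ht0 ht1 hE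
  set f1 := {x | rearrangement f t < ‖f x‖ₑ}.indicator f with hf1
  set f0 := {x | rearrangement f t < ‖f x‖ₑ}ᶜ.indicator f with hf0
  set P := ∫⁻ u in Ioo (0 : ℝ) t, rearrangement f u with hP
  have hsum : ∀ n, fourierMap φ f n = fourierMap φ f0 n + fourierMap φ f1 n := by
    intro n
    rw [fourierMap, fourierMap, fourierMap, ← integral_add (integrable_mul_conj hM hM0 hi0 n)
      (integrable_mul_conj hM hM0 hi1 n)]
    refine integral_congr_ae (.of_forall fun x => ?_)
    simp only
    rw [← add_mul, hf0, hf1, indicator_compl_add_self_apply]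
  have hD : ∀ n, ‖fourierMap φ f1 n‖ₑ ≤ ENNReal.ofReal M * P := fun n =>
    (enorm_fourierMap_le hM f1 n).trans
      (mul_le_mul_right (lintegral_enorm_indicator_gt_le hf ht1) _)
  have hlow : ∑ k ∈ Finset.range j, seqRearrangement (fourierMap φ f0) (k + 1) ^ 2 ≤
      3 * dampedEnergy f t :=
    calc _ ≤ _ := ENNReal.sum_le_tsum _
      _ ≤ _ := tsum_seqRearrangement_sq_le _
      _ ≤ _ := tsum_enorm_fourierMap_sq_le hφ (hf.indicator₀ hS.compl)
      _ ≤ _ := lintegral_enorm_sq_indicator_compl_le_dampedEnergy hf ht0 ht1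
  have hhigh : (j : ℝ≥0∞) * (ENNReal.ofReal M * P) ^ 2 ≤ 2 * dampedEnergy f t := by
    have hP2 := sq_setLIntegral_le_dampedEnergy f ht0 ht1
    calc _ = ENNReal.ofReal (j * M ^ 2) * P ^ 2 := by
          rw [mul_pow, ← mul_assoc, ENNReal.ofReal_mul (by positivity), ENNReal.ofReal_pow hM0,
            ENNReal.ofReal_natCast]
      _ ≤ ENNReal.ofReal (j * N) * (ENNReal.ofReal (2 * t) * dampedEnergy f t) := by gcongr
      _ = ENNReal.ofReal 2 * dampedEnergy f t := by
          rw [← mul_assoc, ← ENNReal.ofReal_mul (by positivity)]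
          congr 2
          rw [ht]
          field_simp
      _ = _ := by norm_num
  calc _ ≤ ∑ k ∈ Finset.range j, 2 * (seqRearrangement (fourierMap φ f0) (k + 1) ^ 2 +
          (ENNReal.ofReal M * P) ^ 2) := Finset.sum_le_sum fun k _ =>
        (pow_le_pow_left' (seqRearrangement_le_add hsum hD (k + 1)) 2).trans
          (add_sq_le_two_mul _ _)
    _ = 2 * (∑ k ∈ Finset.range j, seqRearrangement (fourierMap φ f0) (k + 1) ^ 2 +
          (j : ℝ≥0∞) * (ENNReal.ofReal M * P) ^ 2) := by
        rw [← Finset.mul_sum, Finset.sum_add_distrib, Finset.sum_const, Finset.card_range,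
          nsmul_eq_mul]
    _ ≤ 2 * (3 * dampedEnergy f t + 2 * dampedEnergy f t) := by gcongr
    _ = _ := by ring

end Fourier

/-! ### The norms for `p = q = 2` as weighted square sums. -/

section Norms

theorem ofReal_log_weight_mul_sq (x : ℝ) {g y : ℝ} (hy : 0 < y) (a : ℝ≥0∞) :
    (ENNReal.ofReal (x ^ ((2 : ℝ≥0∞).toReal⁻¹ - (2 : ℝ≥0∞).toReal⁻¹) * y ^ (-(g / 2))) * a) ^
      (2 : ℝ≥0∞).toReal = ENNReal.ofReal (y ^ (-g)) * a ^ 2 := by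
  rw [sub_self, Real.rpow_zero, one_mul, ENNReal.toReal_ofNat, ENNReal.rpow_ofNat, mul_pow,
    ← ENNReal.ofReal_pow (by positivity), ← Real.rpow_natCast, ← Real.rpow_mul hy.le]
  congr 3
  push_cast
  ring

theorem lorentzZygmundNorm_two_two (g : ℝ) (f : ℝ → ℂ) :
    lorentzZygmundNorm 2 2 (-(g / 2)) f =
      (∫⁻ u in Ioo (0 : ℝ) 1, ENNReal.ofReal ((1 + |Real.log u|) ^ (-g)) *
        rearrangement f u ^ 2) ^ (1 / 2 : ℝ) := by
  rw [lorentzZygmundNorm, eLpNorm_eq_lintegral_rpow_enorm_toReal (by norm_num) (by norm_num)]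
  congr 1
  exact setLIntegral_congr_fun measurableSet_Ioo fun u _ =>
    ofReal_log_weight_mul_sq u (by positivity) _

theorem seqLorentzZygmundNorm_two_two {ι : Type*} (g : ℝ) (c : ι → ℂ) :
    seqLorentzZygmundNorm 2 2 (-(g / 2)) c =
      (∑' j : ℕ, ENNReal.ofReal ((1 + Real.log ((j + 1 : ℕ) : ℝ)) ^ (-g)) *
        seqRearrangement c (j + 1) ^ 2) ^ (1 / 2 : ℝ) := by
  rw [seqLorentzZygmundNorm, eLpNorm_eq_lintegral_rpow_enorm_toReal (by norm_num) (by norm_num),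
    lintegral_count]
  congr 1
  refine tsum_congr fun j => ofReal_log_weight_mul_sq _ ?_ _
  have : 0 ≤ Real.log ((j + 1 : ℕ) : ℝ) := Real.log_natCast_nonneg _
  linarith

end Norms

/-! ### Summation over dyadic levels and dependence on `M`. -/

section Main

theorem tsum_dyadicIncrement_mul_dampedEnergy_le {g : ℝ} (hg : 0 < g) {N : ℝ} (hN : 1 ≤ N)
    (f : ℝ → ℂ) :
    ∑' i : ℕ, ENNReal.ofReal (dyadicIncrement g i) * dampedEnergy f (1 / (N * (2 ^ i : ℕ))) ≤
      ENNReal.ofReal (dyadicConst g * (1 + Real.log N) ^ g) *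
        ∫⁻ u in Ioo (0 : ℝ) 1, ENNReal.ofReal ((1 + |Real.log u|) ^ (-g)) *
          rearrangement f u ^ 2 := by
  have hmeas := measurable_rearrangement f
  have hterm : ∀ i : ℕ,
      ENNReal.ofReal (dyadicIncrement g i) * dampedEnergy f (1 / (N * (2 ^ i : ℕ))) =
      ∫⁻ u in Ioo (0 : ℝ) 1, ENNReal.ofReal (dyadicIncrement g i) *
        ENNReal.ofReal (min 1 (√(u * (N * 2 ^ i)))) * rearrangement f u ^ 2 := by
    intro i
    rw [dampedEnergy, ← lintegral_const_mul' _ _ ENNReal.ofReal_ne_top]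
    refine lintegral_congr fun u => ?_
    rw [one_div, div_inv_eq_mul, mul_assoc]
    push_cast
    rfl
  simp_rw [hterm]
  rw [← lintegral_tsum fun i => by fun_prop, ← lintegral_const_mul' _ _ ENNReal.ofReal_ne_top]
  refine setLIntegral_mono (by fun_prop) fun u hu => ?_
  rw [ENNReal.tsum_mul_right, ← mul_assoc]
  exact mul_le_mul_left (tsum_dyadicIncrement_min_le_log hg hN hu) _

theorem tsum_log_weight_seqRearrangement_sq_le {ι : Type*} {φ : ι → Lp ℂ 2 unitMeasure}
    (hφ : Orthonormal ℂ φ) {g : ℝ} (hg : 0 < g) {M N : ℝ} (hM0 : 0 ≤ M)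
    (hM : ∀ n, ∀ᵐ x ∂unitMeasure, ‖φ n x‖ₑ ≤ ENNReal.ofReal M) (hN : 1 ≤ N) (hMN : M ^ 2 ≤ N)
    {f : ℝ → ℂ} (hf : AEStronglyMeasurable f unitMeasure) :
    ∑' j : ℕ, ENNReal.ofReal ((1 + Real.log ((j + 1 : ℕ) : ℝ)) ^ (-g)) *
        seqRearrangement (fourierMap φ f) (j + 1) ^ 2 ≤
      ENNReal.ofReal (10 * 2 ^ g * dyadicConst g * (1 + Real.log N) ^ g) *
        ∫⁻ u in Ioo (0 : ℝ) 1, ENNReal.ofReal ((1 + |Real.log u|) ^ (-g)) *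
          rearrangement f u ^ 2 := by
  calc _ ≤ _ := tsum_log_weight_mul_le hg _
    _ ≤ ENNReal.ofReal (2 ^ g) * ∑' i : ℕ, ENNReal.ofReal (dyadicIncrement g i) *
          (10 * dampedEnergy f (1 / (N * (2 ^ i : ℕ)))) := by
        gcongr with i
        exact sum_range_seqRearrangement_sq_le hφ hM0 hM hN hMN hf (by positivity)
    _ = ENNReal.ofReal (10 * 2 ^ g) * ∑' i : ℕ, ENNReal.ofReal (dyadicIncrement g i) *
          dampedEnergy f (1 / (N * (2 ^ i : ℕ))) := by
        simp_rw [mul_left_comm _ (10 : ℝ≥0∞)]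
        rw [ENNReal.tsum_mul_left, ENNReal.ofReal_mul (by norm_num), ENNReal.ofReal_ofNat]
        ring
    _ ≤ _ := mul_le_mul_right (tsum_dyadicIncrement_mul_dampedEnergy_le hg hN f) _
    _ = _ := by
        rw [← mul_assoc, ← ENNReal.ofReal_mul (by positivity), ← mul_assoc]

theorem integrable_of_log_weight_lintegral_ne_top {g : ℝ} (hg : 0 < g) {f : ℝ → ℂ}
    (hf : AEStronglyMeasurable f unitMeasure)
    (h : ∫⁻ u in Ioo (0 : ℝ) 1, ENNReal.ofReal ((1 + |Real.log u|) ^ (-g)) *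
      rearrangement f u ^ 2 ≠ ⊤) : Integrable f unitMeasure := by
  -- The single term `i = 0` with `N = 1` contains `dampedEnergy f 1` with a positive coefficient,
  -- so this energy is finite and truncation at `t = 1` splits `f` into two integrable parts.
  have h1 := (ENNReal.le_tsum 0).trans
    (tsum_dyadicIncrement_mul_dampedEnergy_le hg le_rfl f)
  have hv : 0 < dyadicIncrement g 0 := by
    have : (1 + 1 : ℝ) ^ (-g) < 1 := Real.rpow_lt_one_of_one_lt_of_neg (by norm_num) (by linarith)
    simp only [dyadicIncrement, dyadicWeight]
    norm_num at this ⊢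
    exact this
  have hE : dampedEnergy f 1 ≠ ⊤ := by
    intro hE
    norm_num [hE] at h1
    rw [ENNReal.mul_top (by simpa using hv), top_le_iff] at h1
    exact ENNReal.mul_ne_top ENNReal.ofReal_ne_top h h1
  obtain ⟨hi1, hi0⟩ := integrable_indicator_of_dampedEnergy_ne_top hf one_pos le_rfl hE
  have := hi1.add hi0
  rwa [indicator_self_add_compl] at this

/-- On a probability space `1 = ‖φ_n‖_2 ≤ ‖φ_n‖_∞`. This makes `log M ≥ 0` and allows `N = M²`. -/
theorem one_le_of_orthonormal {ι : Type*} [Nonempty ι] {φ : ι → Lp ℂ 2 unitMeasure}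
    (hφ : Orthonormal ℂ φ) {M : ℝ}
    (hM : (⨆ n, eLpNorm (φ n) ∞ unitMeasure) = ENNReal.ofReal M) : 1 ≤ M := by
  obtain ⟨n⟩ := ‹Nonempty ι›
  have h2 : eLpNorm (φ n) 2 unitMeasure = 1 := by
    have h := hφ.1 n
    rw [Lp.norm_def] at h
    exact (ENNReal.toReal_eq_one_iff _).1 h
  rw [← ENNReal.one_le_ofReal, ← hM, ← h2]
  exact (eLpNorm_le_eLpNorm_of_exponent_le le_top (Lp.aestronglyMeasurable (φ n))).trans
    (le_iSup (fun n => eLpNorm (φ n) ∞ unitMeasure) n)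

/-- Raise `y ≤ b e^(y/b)` with `y = 1 + log M` to the power `b`; the exponential becomes `e · M`. -/
theorem one_add_log_rpow_le {b : ℝ} (hb : 0 < b) {M : ℝ} (hM : 1 ≤ M) :
    (1 + Real.log M) ^ b ≤ b ^ b * Real.exp 1 * M := by
  have hlog := Real.log_nonneg hM
  have h1 : 1 + Real.log M ≤ b * Real.exp ((1 + Real.log M) / b) := by
    have := Real.add_one_le_exp ((1 + Real.log M) / b)
    rw [← div_le_iff₀' hb]
    linarith
  calc _ ≤ (b * Real.exp ((1 + Real.log M) / b)) ^ b :=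
        Real.rpow_le_rpow (by linarith) h1 hb.le
    _ = _ := by
        rw [Real.mul_rpow hb.le (Real.exp_pos _).le, ← Real.exp_mul, div_mul_cancel₀ _ hb.ne',
          Real.exp_add, Real.exp_log (by linarith), mul_assoc]

theorem rpow_one_add_log_sq_le {g b : ℝ} (hg : 0 < g) (hb : g / 2 ≤ b) {M : ℝ} (hM : 1 ≤ M) :
    (1 + Real.log (M ^ 2)) ^ g ≤
      2 ^ g * ((1 + b ^ b * Real.exp 1) * min M ((1 + Real.log M) ^ b)) ^ 2 := by
  have hlog := Real.log_nonneg hM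
  have hb0 : 0 < b := by linarith
  have hD : 0 ≤ b ^ b * Real.exp 1 := by positivity
  set X := (1 + Real.log M) ^ b with hX
  have hX0 : 0 ≤ X := by positivity
  have hmin : X ≤ (1 + b ^ b * Real.exp 1) * min M X := by
    rw [mul_min_of_nonneg _ _ (by linarith)]
    refine le_min ?_ ?_
    · have := one_add_log_rpow_le hb0 hM
      rw [← hX] at this
      linarith
    · nlinarith
  have h2b : (1 + Real.log M) ^ g ≤ X ^ 2 := by
    rw [hX, ← Real.rpow_natCast, ← Real.rpow_mul (by linarith)]
    exact Real.rpow_le_rpow_of_exponent_le (by linarith) (by push_cast; linarith)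
  calc _ ≤ (2 * (1 + Real.log M)) ^ g := by
        rw [Real.log_pow]
        push_cast
        exact Real.rpow_le_rpow (by linarith) (by linarith) hg.le
    _ = 2 ^ g * (1 + Real.log M) ^ g := Real.mul_rpow (by norm_num) (by linarith)
    _ ≤ _ := mul_le_mul_of_nonneg_left
        (h2b.trans (pow_le_pow_left₀ hX0 hmin 2)) (by positivity)

end Main

theorem corollary3p2 (α : ℝ) (hα : α < -(1 / 2)) :
    ∃ C : ℝ, 0 < C ∧
      ∀ (ι : Type) [Countable ι] [Nonempty ι] (φ : ι → Lp ℂ 2 unitMeasure) (M : ℝ),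
        Orthonormal ℂ φ →
        (⨆ n, eLpNorm (φ n) ∞ unitMeasure) = ENNReal.ofReal M →
        ∀ f : ℝ → ℂ, MemLorentzZygmund 2 2 (α + 1 / 2) f →
          (∀ n, Integrable (fun x => f x * conj (φ n x)) unitMeasure) ∧
          MemSeqLorentzZygmund 2 2 (α + 1 / 2) (fourierMap φ f) ∧
          seqLorentzZygmundNorm 2 2 (α + 1 / 2) (fourierMap φ f) ≤
            ENNReal.ofReal (C * min M ((1 + Real.log M) ^ |α|)) *
              lorentzZygmundNorm 2 2 (α + 1 / 2) f := by
  obtain ⟨g, hgα⟩ : ∃ g : ℝ, g = -(2 * α + 1) := ⟨_, rfl⟩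
  have hg : 0 < g := by linarith
  have hβ : α + 1 / 2 = -(g / 2) := by rw [hgα]; ring
  have hα_abs : |α| = -α := abs_of_neg (by linarith)
  have hgb : g / 2 ≤ |α| := by linarith
  have hb0 : 0 < |α| := by linarith
  have hK0 : 0 ≤ 10 * 2 ^ g * dyadicConst g * 2 ^ g :=
    mul_nonneg (mul_nonneg (by positivity) (dyadicConst_nonneg g)) (by positivity)
  obtain ⟨K, hK⟩ : ∃ K : ℝ, K = 10 * 2 ^ g * dyadicConst g * 2 ^ g := ⟨_, rfl⟩
  rw [← hK] at hK0
  -- The summand `1` keeps the constant positive, since only `0 ≤ K` is at hand.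
  refine ⟨(√K + 1) * (1 + |α| ^ |α| * Real.exp 1), by positivity, ?_⟩
  intro ι _ _ φ M hφ hM f ⟨hf, hnorm⟩
  have hM1 := one_le_of_orthonormal hφ hM
  have hM0 : 0 ≤ M := by linarith
  have hlog := Real.log_nonneg hM1
  have hMae : ∀ n, ∀ᵐ x ∂unitMeasure, ‖φ n x‖ₑ ≤ ENNReal.ofReal M := fun n => by
    have hn : eLpNormEssSup (φ n) unitMeasure ≤ ENNReal.ofReal M := by
      rw [← hM, ← eLpNorm_exponent_top]
      exact le_iSup (fun n => eLpNorm (φ n) ∞ unitMeasure) n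
    exact ae_le_eLpNormEssSup.mono fun x hx => hx.trans hn
  rw [hβ] at hnorm ⊢
  have hZ : ∫⁻ u in Ioo (0 : ℝ) 1, ENNReal.ofReal ((1 + |Real.log u|) ^ (-g)) *
      rearrangement f u ^ 2 ≠ ⊤ := by
    intro h
    rw [lorentzZygmundNorm_two_two, h, ENNReal.top_rpow_of_pos (by norm_num)] at hnorm
    exact lt_irrefl _ hnorm
  have hint := integrable_of_log_weight_lintegral_ne_top hg hf hZ
  have hbound : seqLorentzZygmundNorm 2 2 (-(g / 2)) (fourierMap φ f) ≤
      ENNReal.ofReal ((√K + 1) * (1 + |α| ^ |α| * Real.exp 1) *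
        min M ((1 + Real.log M) ^ |α|)) * lorentzZygmundNorm 2 2 (-(g / 2)) f := by
    have h := tsum_log_weight_seqRearrangement_sq_le hφ hg hM0 hMae
      (one_le_pow₀ hM1 (n := 2)) le_rfl hf
    set Y := (1 + |α| ^ |α| * Real.exp 1) * min M ((1 + Real.log M) ^ |α|) with hY
    have hY0 : 0 ≤ Y := mul_nonneg (by positivity) (le_min hM0 (by positivity))
    have hconst : 10 * 2 ^ g * dyadicConst g * (1 + Real.log (M ^ 2)) ^ g ≤
        ((√K + 1) * Y) ^ 2 :=
      calc _ ≤ 10 * 2 ^ g * dyadicConst g * (2 ^ g * Y ^ 2) :=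
            mul_le_mul_of_nonneg_left (rpow_one_add_log_sq_le hg hgb hM1)
              (mul_nonneg (by positivity) (dyadicConst_nonneg g))
        _ = (√K * Y) ^ 2 := by rw [mul_pow (√K), Real.sq_sqrt hK0, hK]; ring
        _ ≤ _ := pow_le_pow_left₀ (by positivity)
            (mul_le_mul_of_nonneg_right (by linarith) hY0) 2
    rw [seqLorentzZygmundNorm_two_two, lorentzZygmundNorm_two_two, mul_assoc (√K + 1), ← hY]
    calc _ ≤ _ := ENNReal.rpow_le_rpow (h.trans
          (mul_le_mul_left (ENNReal.ofReal_le_ofReal hconst) _)) (by norm_num)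
      _ = _ := by
          rw [ENNReal.mul_rpow_of_nonneg _ _ (by norm_num), ENNReal.ofReal_pow (by positivity),
            ← ENNReal.rpow_natCast, ← ENNReal.rpow_mul]
          norm_num
  refine ⟨integrable_mul_conj hMae hM0 hint, ⟨⟨M * (∫⁻ x, ‖f x‖ₑ ∂unitMeasure).toReal,
    fun n => ?_⟩, ?_⟩, hbound⟩
  · have h := ENNReal.toReal_mono (ENNReal.mul_ne_top ENNReal.ofReal_ne_top hint.2.ne)
      (enorm_fourierMap_le hMae f n)
    rwa [toReal_enorm, ENNReal.toReal_mul, ENNReal.toReal_ofReal hM0] at h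
  · exact hbound.trans_lt (ENNReal.mul_lt_top ENNReal.ofReal_lt_top hnorm)
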